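/- Let $(\Omega,\mathcal A,P)$ be a probability space, $U$ a separable real Banach space with dual $U^*$, and $H\in(0,1)$. Put $R(s,t)=\tfrac12\left(s^{2H}+t^{2H}-|s-t|^{2H}\right)$ for $s,t\ge 0$. A Gaussian process $(b(t))_{t\ge0}$ in $\mathbb R^n$ is a fractional Brownian motion (fBm) with Hurst parameter $H$ if there is a matrix $M\in\mathbb R^{n\times n}$ with $E[\langle\alpha,b(s)\rangle]=0$ and $E[\langle\alpha,b(s)\rangle\langle\beta,b(t)\rangle]=\langle M\alpha,\beta\rangle R(s,t)$ for all $s,t\ge0$ and $\alpha,\beta\in\mathbb R^n$; it is standard if $M=\mathrm{Id}$. A cylindrical process in $U$ is a family $(B(t))_{t\ge0}$ of linear maps $B(t):U^*\to L^0_P(\Omega;\mathbb R)$ that are continuous with respect to convergence in probability. It is a cylindrical fBm with Hurst parameter $H$ if for all $n\in\mathbb N$ and $u_1^*,\dots,u_n^*\in U^*$ the process $(B(t)u_1^*,\dots,B(t)u_n^*)_{t\ge0}$ is an fBm with Hurst parameter $H$ in $\mathbb R^n$, and the covariance operator $Q$ of $B(1)$, given by $\langle Qu^*,v^*\rangle=E[(B(1)u^*)(B(1)v^*)]$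 for $u^*,v^*\in U^*$, takes values in $U$. **Theorem.** For a cylindrical process $B=(B(t))_{t\ge0}$ in $U$ the following are equivalent: (a) $B$ is a cylindrical fBm with Hurst parameter $H$; (b) there exist a real Hilbert space $X$ with a finite or countably infinite orthonormal basis $(e_k)_{1\le k\le N}$ if $N\in\{0,1,2,\dots\}$, or $(e_k)_{k\ge 1}$ if $N=\infty$, a bounded linear operator $i\in\mathcal L(X,U)$, and a sequence $(b_k)$ with the same index set of independent real valued standard fBms on $(\Omega,\mathcal A,P)$ with Hurst parameter $H$, such that for all $u^*\in U^*$ and $t\ge0$ $$B(t)u^*=\sum_{k=1}^{N}\langle ie_k,u^*\rangle\, b_k(t)\qquad\text{in }L^2_P(\Omega;\mathbb R).$$ Moreover, for every representation of $B$ as in (b), the covariance operator of $B(1)$ is $Q=ii^*:U^*\to U$, where $i^*:U^*\to X$ is the adjoint of $i$ and $X$ is identified with its dual. -/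

import Mathlib

open MeasureTheory ProbabilityTheory Filter Topology
open scoped NNReal ENNReal

namespace CylFBM

/-- The covariance function `R(s,t) = (s^{2H} + t^{2H} - |s-t|^{2H}) / 2` of a standard real
fractional Brownian motion with Hurst parameter `H`. -/
noncomputable def R (H : ℝ) (s t : ℝ≥0) : ℝ :=
  ((s : ℝ) ^ (2 * H) + (t : ℝ) ^ (2 * H) - |(s : ℝ) - (t : ℝ)| ^ (2 * H)) / 2

/-- `b` is a fractional Brownian motion with Hurst parameter `H` and covariance matrix `M`
(written as an endomorphism) in the Euclidean space `E`: a centred Gaussian process with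
`E[⟨α, b(s)⟩ ⟨β, b(t)⟩] = ⟨M α, β⟩ R(s,t)`. It is used for `E = ℝⁿ` and `E = ℝ`. -/
structure IsFBmWithCov {Ω : Type*} [MeasurableSpace Ω] (P : Measure Ω)
    {E : Type*} [NormedAddCommGroup E] [InnerProductSpace ℝ E] [MeasurableSpace E]
    (H : ℝ) (M : E →ₗ[ℝ] E) (b : ℝ≥0 → Ω → E) : Prop where
  measurable : ∀ t, Measurable (b t)
  gaussian : IsGaussianProcess b P
  mean : ∀ (s : ℝ≥0) (α : E), ∫ ω, inner ℝ α (b s ω) ∂P = 0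
  cov : ∀ (s t : ℝ≥0) (α β : E),
    ∫ ω, inner ℝ α (b s ω) * inner ℝ β (b t ω) ∂P = inner ℝ (M α) β * R H s t

/-- A fractional Brownian motion with Hurst parameter `H` in `E`. -/
def IsFBm {Ω : Type*} [MeasurableSpace Ω] (P : Measure Ω)
    {E : Type*} [NormedAddCommGroup E] [InnerProductSpace ℝ E] [MeasurableSpace E]
    (H : ℝ) (b : ℝ≥0 → Ω → E) : Prop :=
  ∃ M : E →ₗ[ℝ] E, IsFBmWithCov P H M b

/-- A real valued standard fractional Brownian motion (covariance matrix `Id`). -/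
def IsStandardRealFBm {Ω : Type*} [MeasurableSpace Ω] (P : Measure Ω)
    (H : ℝ) (b : ℝ≥0 → Ω → ℝ) : Prop :=
  IsFBmWithCov P H LinearMap.id b

/-- A linear map `Z : U* → L⁰(Ω; ℝ)` is a cylindrical random variable in `U` if it is continuous
for the norm of `U*` and convergence in probability. -/
def IsCylindricalRandomVariable {Ω : Type*} [MeasurableSpace Ω] (P : Measure Ω)
    {U : Type*} [NormedAddCommGroup U] [NormedSpace ℝ U]
    (Z : StrongDual ℝ U →ₗ[ℝ] (Ω →ₘ[P] ℝ)) : Prop :=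
  ∀ u : StrongDual ℝ U, TendstoInMeasure P (fun v ω => Z v ω) (𝓝 u) (Z u)

/-- A cylindrical process in `U`: a family `(B(t) : t ≥ 0)` of cylindrical random variables. -/
def IsCylindricalProcess {Ω : Type*} [MeasurableSpace Ω] (P : Measure Ω)
    {U : Type*} [NormedAddCommGroup U] [NormedSpace ℝ U]
    (B : ℝ≥0 → StrongDual ℝ U →ₗ[ℝ] (Ω →ₘ[P] ℝ)) : Prop :=
  ∀ t, IsCylindricalRandomVariable P (B t)

/-- The covariance operator of the (centred, square integrable) cylindrical random variable `Z`
is `U`-valued and equal to `Q`: `⟨Q u*, v*⟩ = E[(Z u*) (Z v*)]` for all `u*, v* ∈ U*`. -/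
def HasCovarianceOperator {Ω : Type*} [MeasurableSpace Ω] (P : Measure Ω)
    {U : Type*} [NormedAddCommGroup U] [NormedSpace ℝ U]
    (Z : StrongDual ℝ U →ₗ[ℝ] (Ω →ₘ[P] ℝ)) (Q : StrongDual ℝ U → U) : Prop :=
  (∀ u : StrongDual ℝ U, MemLp (Z u) 2 P) ∧
    ∀ u v : StrongDual ℝ U, v (Q u) = ∫ ω, Z u ω * Z v ω ∂P

/-- `B` is a cylindrical fractional Brownian motion in `U` with Hurst parameter `H`:
(a) all its finite dimensional projections are fractional Brownian motions, and
(b) the covariance operator of `B(1)` is `U`-valued. -/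
structure IsCylindricalFBm {Ω : Type*} [MeasurableSpace Ω] (P : Measure Ω)
    {U : Type*} [NormedAddCommGroup U] [NormedSpace ℝ U]
    (H : ℝ) (B : ℝ≥0 → StrongDual ℝ U →ₗ[ℝ] (Ω →ₘ[P] ℝ)) : Prop where
  isCylindricalProcess : IsCylindricalProcess P B
  projections : ∀ (n : ℕ) (u : Fin n → StrongDual ℝ U),
    IsFBm P H (fun (t : ℝ≥0) (ω : Ω) =>
      (WithLp.toLp 2 (fun j => B t (u j) ω) : EuclideanSpace ℝ (Fin n)))
  covariance : ∃ Q : StrongDual ℝ U → U, HasCovarianceOperator P (B 1) Q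

/-- The index set `{k ∈ ℕ | k < N}` of a sequence of length `N ∈ ℕ ∪ {∞}`. For `N = ∞` it is all
of `ℕ`. -/
abbrev Idx (N : ℕ∞) : Type := {k : ℕ // (k : ℕ∞) < N}

/-- The indices among the first `n` ones. -/
noncomputable def firstIdx (N : ℕ∞) (n : ℕ) : Finset (Idx N) :=
  (Finset.range n).subtype (fun k : ℕ => (k : ℕ∞) < N)

/-- The data `(e_k)`, `i`, `(b_k)` represent `B` as a series: the `b_k` are independent (as
processes) real valued standard fractional Brownian motions with Hurst parameter `H`, and
`B(t)u* = ∑_k ⟨i e_k, u*⟩ b_k(t)` in `L²(Ω; ℝ)`, as the limit of the partial sums. -/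
structure IsSeriesRepresentation {Ω : Type*} [MeasurableSpace Ω] (P : Measure Ω)
    {U : Type*} [NormedAddCommGroup U] [NormedSpace ℝ U]
    (H : ℝ) (B : ℝ≥0 → StrongDual ℝ U →ₗ[ℝ] (Ω →ₘ[P] ℝ))
    {X : Type*} [NormedAddCommGroup X] [InnerProductSpace ℝ X]
    {N : ℕ∞} (e : HilbertBasis (Idx N) ℝ X) (i : X →L[ℝ] U)
    (b : Idx N → ℝ≥0 → Ω → ℝ) : Prop where
  standard : ∀ k, IsStandardRealFBm P H (b k)
  indep : iIndepFun (fun k ω t => b k t ω) P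
  series : ∀ (t : ℝ≥0) (u : StrongDual ℝ U),
    Tendsto (fun n : ℕ =>
      eLpNorm (fun ω => B t u ω - ∑ k ∈ firstIdx N n, u (i (e k)) * b k t ω) 2 P)
      atTop (𝓝 0)

/-- The adjoint `i* : U* → X` of `i : X → U`, where `X` is identified with its dual, so that
`[i* u*, x] = ⟨i x, u*⟩`. -/
noncomputable def adjointOp {U : Type*} [NormedAddCommGroup U] [NormedSpace ℝ U]
    {X : Type*} [NormedAddCommGroup X] [InnerProductSpace ℝ X] [CompleteSpace X]
    (i : X →L[ℝ] U) (u : StrongDual ℝ U) : X :=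
  (InnerProductSpace.toDual ℝ X).symm (u.comp i)

end CylFBM

/-! From series to fBm: the partial sums are linear images of the jointly Gaussian family `b k t`,
and L² limits preserve joint Gaussianity. By orthogonality of the `b k` and Parseval, E[B(s)u ·
B(t)v] = [i*u, i*v] R(s,t), which gives the projections and Q = ii* (`isFBm_projection`,
`IsSeriesRepresentation.integral_mul`).

From fBm to series: everything is decided at time 1. By the closed graph theorem J = B(1) : U* →
L²(P) is bounded, and its adjoint J* : L² → U** satisfies J*J = Q, so J* maps the range of J into U.
Although U* need not be separable, countably many functionals separate the points of U. Gram–Schmidt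
on their images yields orthonormal vectors J w_k, whose closed span contains the whole range of J
because J* is U-valued there (`exists_orthonormal_range`). Sending e_k to J w_k and applying J*
defines i, and J u = ∑ ⟨i e_k, u⟩ J w_k (`exists_embedding`). Set b_k(t) = B(t)w_k: these are
jointly Gaussian and uncorrelated for different k, hence independent. The expansion passes to every
t because E|B(t)v|² = R(t,t) ‖Jv‖². -/

namespace CylFBM

/-! ### Gaussian laws and processes under L² limits and independence -/

section GaussianLimits

variable {Ω : Type*} [MeasurableSpace Ω] {P : Measure Ω}

/-- The integral is the L² inner product, which is jointly continuous. With `G = 1` it also gives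
convergence of means. -/
lemma tendsto_integral_mul {f g : Ω → ℝ} {F G : ℕ → Ω → ℝ}
    (hf : MemLp f 2 P) (hg : MemLp g 2 P) (hF : ∀ n, MemLp (F n) 2 P) (hG : ∀ n, MemLp (G n) 2 P)
    (hFf : Tendsto (fun n => eLpNorm (fun ω => f ω - F n ω) 2 P) atTop (𝓝 0))
    (hGg : Tendsto (fun n => eLpNorm (fun ω => g ω - G n ω) 2 P) atTop (𝓝 0)) :
    Tendsto (fun n => ∫ ω, F n ω * G n ω ∂P) atTop (𝓝 (∫ ω, f ω * g ω ∂P)) := by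
  have key : ∀ {p q : Ω → ℝ} (hp : MemLp p 2 P) (hq : MemLp q 2 P),
      ∫ ω, p ω * q ω ∂P = inner ℝ (hp.toLp p) (hq.toLp q) := by
    intro p q hp hq
    rw [L2.inner_def]
    refine integral_congr_ae ?_
    filter_upwards [hp.coeFn_toLp, hq.coeFn_toLp] with ω h1 h2
    rw [h1, h2, real_inner_eq_re_inner]
    simp [mul_comm]
  have conv : ∀ {p : Ω → ℝ} {S : ℕ → Ω → ℝ} (hp : MemLp p 2 P) (hS : ∀ n, MemLp (S n) 2 P),
      Tendsto (fun n => eLpNorm (fun ω => p ω - S n ω) 2 P) atTop (𝓝 0) →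
      Tendsto (fun n => (hS n).toLp (S n)) atTop (𝓝 (hp.toLp p)) := by
    intro p S hp hS h
    rw [Lp.tendsto_Lp_iff_tendsto_eLpNorm'']
    refine h.congr fun n => ?_
    rw [eLpNorm_sub_comm]
    rfl
  simp_rw [fun n => key (hF n) (hG n), key hf hg]
  exact (conv hf hF hFf).inner (conv hg hG hGg)

lemma memLp_of_tendsto_eLpNorm {f : Ω → ℝ} {F : ℕ → Ω → ℝ}
    (hf : AEStronglyMeasurable f P) (hF : ∀ n, MemLp (F n) 2 P)
    (hFf : Tendsto (fun n => eLpNorm (fun ω => f ω - F n ω) 2 P) atTop (𝓝 0)) : MemLp f 2 P := by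
  obtain ⟨n, hn⟩ := (hFf.eventually (gt_mem_nhds ENNReal.zero_lt_top)).exists
  have h : MemLp (fun ω => f ω - F n ω) 2 P := ⟨hf.sub (hF n).1, hn⟩
  have h' := h.add (hF n)
  rwa [show (fun ω => f ω - F n ω) + F n = f from funext fun ω => sub_add_cancel _ _] at h'

variable [IsProbabilityMeasure P]

/-- Means and variances converge, so the Gaussian characteristic functions converge to the Gaussian
one with the limiting parameters; convergence in distribution identifies this limit with the
characteristic function of `f`. -/
lemma hasGaussianLaw_of_tendsto_eLpNorm {f : Ω → ℝ} {F : ℕ → Ω → ℝ}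
    (hf : AEStronglyMeasurable f P) (hF : ∀ n, HasGaussianLaw (F n) P)
    (hFf : Tendsto (fun n => eLpNorm (fun ω => f ω - F n ω) 2 P) atTop (𝓝 0)) :
    HasGaussianLaw f P := by
  have hF2 : ∀ n, MemLp (F n) 2 P := fun n => (hF n).memLp_two
  have hf2 : MemLp f 2 P := memLp_of_tendsto_eLpNorm hf hF2 hFf
  have hmean : Tendsto (fun n => ∫ ω, F n ω ∂P) atTop (𝓝 (∫ ω, f ω ∂P)) := by
    simpa using tendsto_integral_mul hf2 (memLp_const (1 : ℝ)) hF2 (fun _ => memLp_const 1) hFf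
      (by simp)
  have hvar : Tendsto (fun n => Var[F n; P]) atTop (𝓝 Var[f; P]) := by
    simp_rw [fun n => variance_eq_sub (hF2 n), variance_eq_sub hf2, pow_two]
    exact (tendsto_integral_mul hf2 hf2 hF2 hF2 hFf hFf).sub (hmean.mul hmean)
  have hdist : TendstoInDistribution F atTop f (fun _ => P) P := by
    refine TendstoInMeasure.tendstoInDistribution ?_ fun n => (hF n).aemeasurable
    refine tendstoInMeasure_of_tendsto_eLpNorm two_ne_zero (fun n => (hF2 n).1) hf ?_
    refine hFf.congr fun n => ?_
    rw [eLpNorm_sub_comm]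
    rfl
  have hchar : ∀ t : ℝ, Tendsto (fun n => charFun (P.map (F n)) t) atTop
      (𝓝 (charFun (P.map f) t)) :=
    fun t => (ProbabilityMeasure.tendsto_iff_tendsto_charFun.1 hdist.tendsto) t
  rw [hasGaussianLaw_iff_charFun_map_eq hf.aemeasurable]
  intro t
  refine tendsto_nhds_unique (hchar t) ?_
  have haux : ∀ g : Ω → ℝ, (P[fun ω => inner ℝ t (g ω)] : ℝ) = t * ∫ ω, g ω ∂P ∧
      Var[fun ω => inner ℝ t (g ω); P] = t ^ 2 * Var[g; P] := by
    intro g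
    constructor
    · rw [← integral_const_mul]
      simp [mul_comm]
    · rw [← variance_const_mul]
      simp [mul_comm]
  simp_rw [fun n => (hF n).charFun_map_eq t, fun g => (haux g).1, fun g => (haux g).2]
  refine (Complex.continuous_exp.tendsto _).comp ?_
  have h1 := (Complex.continuous_ofReal.tendsto _).comp (hmean.const_mul t)
  have h2 := (Complex.continuous_ofReal.tendsto _).comp (hvar.const_mul (t ^ 2))
  exact (h1.mul_const _).sub (h2.div_const _)

lemma isGaussianProcess_of_tendsto_eLpNorm {T : Type*} {Y : T → Ω → ℝ} {S : ℕ → T → Ω → ℝ}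
    (hY : ∀ t, AEStronglyMeasurable (Y t) P) (hS : ∀ n, IsGaussianProcess (S n) P)
    (hSY : ∀ t, Tendsto (fun n => eLpNorm (fun ω => Y t ω - S n t ω) 2 P) atTop (𝓝 0)) :
    IsGaussianProcess Y P where
  hasGaussianLaw I := by
    have hmeas : AEMeasurable (fun ω => I.restrict (Y · ω)) P :=
      aemeasurable_pi_lambda _ fun t => (hY t).aemeasurable
    refine ⟨isGaussian_of_isGaussian_map fun L => ?_⟩
    rw [AEMeasurable.map_map_of_aemeasurable (by fun_prop) hmeas]
    classical
    have hL : ∀ x : I → ℝ, L x = ∑ t, x t * L (Pi.single t 1) := by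
      intro x
      conv_lhs => rw [← Finset.univ_sum_single x, map_sum]
      refine Finset.sum_congr rfl fun t _ => ?_
      rw [← smul_eq_mul, ← map_smul, ← Pi.single_smul]
      simp
    refine (hasGaussianLaw_of_tendsto_eLpNorm (F := fun n ω => L (I.restrict (S n · ω)))
      ?_ (fun n => ((hS n).hasGaussianLaw I).map L) ?_).isGaussian_map
    · exact L.continuous.comp_aestronglyMeasurable hmeas.aestronglyMeasurable
    · have hbound : ∀ n, eLpNorm (fun ω => (L ∘ fun ω => I.restrict (Y · ω)) ω
            - L (I.restrict (S n · ω))) 2 P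
          ≤ ∑ t : I, ‖L (Pi.single t 1)‖ₑ * eLpNorm (fun ω => Y t ω - S n t ω) 2 P := by
        intro n
        have : (fun ω => (L ∘ fun ω => I.restrict (Y · ω)) ω - L (I.restrict (S n · ω)))
            = ∑ t : I, (L (Pi.single t 1)) • (fun ω => Y t ω - S n t ω) := by
          ext ω
          simp only [Function.comp_apply]
          rw [hL, hL (I.restrict (S n · ω)), ← Finset.sum_sub_distrib, Finset.sum_apply]
          refine Finset.sum_congr rfl fun t _ => ?_
          simp only [Finset.restrict, Pi.smul_apply, smul_eq_mul]
          ring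
        rw [this]
        refine (eLpNorm_sum_le (fun t _ => ?_) (by norm_num)).trans ?_
        · exact ((hY t).sub ((hS n).aemeasurable t).aestronglyMeasurable).const_smul _
        · exact Finset.sum_le_sum fun t _ => (eLpNorm_const_smul _ _ _ _).le
      have hzero : Tendsto (fun n => ∑ t : I, ‖L (Pi.single t 1)‖ₑ *
          eLpNorm (fun ω => Y t ω - S n t ω) 2 P) atTop (𝓝 0) := by
        have h0 : (0 : ℝ≥0∞) = ∑ _t : I, 0 := by simp
        rw [h0]
        refine tendsto_finsetSum _ fun t _ => ?_
        simpa using ENNReal.Tendsto.const_mul (hSY t) (Or.inr enorm_ne_top)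
      exact tendsto_of_tendsto_of_tendsto_of_le_of_le tendsto_const_nhds hzero
        (fun _ => bot_le) hbound

omit [IsProbabilityMeasure P] in
/-- Independent real valued Gaussian processes are jointly Gaussian. -/
lemma isGaussianProcess_of_iIndepFun {K T : Type*} {b : K → T → Ω → ℝ}
    (hb : ∀ k, IsGaussianProcess (b k) P) (hind : iIndepFun (fun k ω t => b k t ω) P) :
    IsGaussianProcess (fun p : K × T => b p.1 p.2) P where
  hasGaussianLaw I := by
    classical
    -- `I` lies in the rectangle `A × D`, where the `D`-marginals for `k ∈ A` are independent
    -- Gaussian vectors; the `I`-marginal is a coordinate projection of them.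
    let A := I.image Prod.fst
    let D := I.image Prod.snd
    have h1 : iIndepFun (fun (k : A) ω => D.restrict (fun t => b (k : K) t ω)) P :=
      (hind.precomp (g := fun k : A => (k : K)) Subtype.val_injective).comp
        (fun _ => D.restrict) (fun _ => by fun_prop)
    have h2 := h1.hasGaussianLaw fun k : A => (hb (k : K)).hasGaussianLaw D
    let L : (A → D → ℝ) →L[ℝ] (I → ℝ) := ContinuousLinearMap.pi fun p =>
      (ContinuousLinearMap.proj (R := ℝ) (φ := fun _ : D => ℝ)
        ⟨p.1.2, Finset.mem_image_of_mem _ p.2⟩).comp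
      (ContinuousLinearMap.proj (R := ℝ) (φ := fun _ : A => D → ℝ)
        ⟨p.1.1, Finset.mem_image_of_mem _ p.2⟩)
    exact h2.map L

end GaussianLimits

end CylFBM
namespace CylFBM

/-! ### Orthonormal expansion in the range of a map with `U`-valued adjoint -/

section Hilbert

lemma mem_firstIdx {N : ℕ∞} {n : ℕ} {k : Idx N} : k ∈ firstIdx N n ↔ (k : ℕ) < n := by
  simp [firstIdx]

lemma tendsto_firstIdx (N : ℕ∞) : Tendsto (firstIdx N) atTop atTop := by
  refine tendsto_atTop_finset_of_monotone (fun m n h k hk => ?_) fun k => ⟨k + 1, ?_⟩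
  · rw [mem_firstIdx] at *
    exact hk.trans_le h
  · rw [mem_firstIdx]
    exact Nat.lt_succ_self _

lemma exists_equiv_idx (S : Set ℕ) : ∃ N : ℕ∞, Nonempty (Idx N ≃ S) := by
  classical
  rcases S.finite_or_infinite with hS | hS
  · have := hS.fintype
    refine ⟨Fintype.card S, ⟨(Equiv.subtypeEquivRight fun k => ?_).trans
      (Fin.equivSubtype.symm.trans (Fintype.equivFin S).symm)⟩⟩
    exact Nat.cast_lt
  · have := hS.to_subtype
    refine ⟨⊤, ⟨(Equiv.subtypeUnivEquiv fun k => ?_).trans (nonempty_denumerable S).some.eqv.symm⟩⟩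
    exact ENat.natCast_lt_top k

variable {U : Type*} [NormedAddCommGroup U] [NormedSpace ℝ U]

/-- The dual of a separable space contains a sequence separating points. -/
lemma exists_separating_seq [TopologicalSpace.SeparableSpace U] :
    ∃ v : ℕ → StrongDual ℝ U, ∀ x : U, (∀ m, v m x = 0) → x = 0 := by
  choose g hg1 hg2 using fun x : U => exists_dual_vector'' ℝ x
  refine ⟨fun m => g (TopologicalSpace.denseSeq U m), fun x hx => ?_⟩
  by_contra hne
  have hpos : 0 < ‖x‖ := norm_pos_iff.2 hne
  obtain ⟨m, hm⟩ := (TopologicalSpace.denseRange_denseSeq U).exists_dist_lt x (half_pos hpos)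
  set y := TopologicalSpace.denseSeq U m
  -- The functional `g y` norms `y` and vanishes at `x`, so a nonzero `x` cannot be approximated by
  -- such `y`.
  have h1 : ‖y‖ ≤ ‖x - y‖ := by
    have h2 : g y (y - x) = ‖y‖ := by rw [map_sub, hx m, hg2]; simp
    have h3 := (g y).le_of_opNorm_le (hg1 y) (y - x)
    rw [h2, one_mul, norm_sub_rev] at h3
    simpa using h3
  rw [dist_eq_norm] at hm
  have h4 : ‖x‖ ≤ ‖x - y‖ + ‖y‖ := by simpa using norm_add_le (x - y) y
  linarith

variable {E : Type*} [NormedAddCommGroup E] [InnerProductSpace ℝ E]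

/-- The adjoint `E → U**` of `J : U* → E`. -/
noncomputable def bidualAdjoint (J : StrongDual ℝ U →L[ℝ] E) :
    E →L[ℝ] StrongDual ℝ (StrongDual ℝ U) :=
  ((ContinuousLinearMap.compL ℝ (StrongDual ℝ U) E ℝ).flip J).comp (innerSL ℝ)

/-- The vectors of `E` that the adjoint of `J : U* → E` maps into `U`. -/
noncomputable def preadjointDomain (J : StrongDual ℝ U →L[ℝ] E) : Submodule ℝ E :=
  (LinearMap.range (NormedSpace.inclusionInDoubleDualLi ℝ (E := U)).toLinearMap).comap
    (bidualAdjoint J).toLinearMap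

lemma mem_preadjointDomain {J : StrongDual ℝ U →L[ℝ] E} {x : E} :
    x ∈ preadjointDomain J ↔ ∃ y : U, ∀ v, v y = inner ℝ x (J v) := by
  constructor
  · rintro ⟨y, hy⟩
    exact ⟨y, fun v => congrArg (fun f : StrongDual ℝ (StrongDual ℝ U) => f v) hy⟩
  · rintro ⟨y, hy⟩
    exact ⟨y, ContinuousLinearMap.ext hy⟩

/-- Completeness of `U` makes its isometric image in the bidual closed. -/
lemma isClosed_preadjointDomain [CompleteSpace U] (J : StrongDual ℝ U →L[ℝ] E) :
    IsClosed (preadjointDomain J : Set E) := by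
  have h : IsClosed (Set.range (NormedSpace.inclusionInDoubleDualLi ℝ (E := U))) :=
    (NormedSpace.inclusionInDoubleDualLi ℝ
      (E := U)).isometry.isUniformInducing.isComplete_range.isClosed
  exact h.preimage (bidualAdjoint J).continuous

/-- The adjoint of `J : U* → E` along `T : X → E`, when it is `U`-valued. -/
lemma exists_preadjoint {X : Type*} [NormedAddCommGroup X] [NormedSpace ℝ X]
    (J : StrongDual ℝ U →L[ℝ] E) (T : X →L[ℝ] E) (hT : ∀ x, T x ∈ preadjointDomain J) :
    ∃ i : X →L[ℝ] U, ∀ x v, v (i x) = inner ℝ (T x) (J v) := by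
  choose y hy using fun x => mem_preadjointDomain.1 (hT x)
  have ext' : ∀ a b : U, (∀ v : StrongDual ℝ U, v a = v b) → a = b := fun a b h =>
    (SeparatingDual.eq_iff_forall_dual_eq (R := ℝ)).2 h
  refine ⟨LinearMap.mkContinuous
    { toFun := y
      map_add' := fun a b => ext' _ _ fun v => by
        rw [map_add, hy, hy, hy, map_add, inner_add_left]
      map_smul' := fun c a => ext' _ _ fun v => by
        rw [RingHom.id_apply, map_smul, hy, hy, map_smul, real_inner_smul_left, smul_eq_mul] }
    (‖T‖ * ‖J‖) fun x => ?_, fun x v => hy x v⟩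
  refine NormedSpace.norm_le_dual_bound ℝ _ (by positivity) fun v => ?_
  change ‖v (y x)‖ ≤ _
  rw [hy]
  calc ‖inner ℝ (T x) (J v)‖ ≤ ‖T x‖ * ‖J v‖ := norm_inner_le_norm _ _
    _ ≤ (‖T‖ * ‖x‖) * (‖J‖ * ‖v‖) := by
        gcongr
        · exact T.le_opNorm x
        · exact J.le_opNorm v
    _ = ‖T‖ * ‖J‖ * ‖x‖ * ‖v‖ := by ring

variable [CompleteSpace E] [CompleteSpace U]

/-- If the adjoint of `J` maps the range of `J` into the separable space `U`, then the closure of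
the range of `J` has an orthonormal basis consisting of values of `J`. -/
lemma exists_orthonormal_range [TopologicalSpace.SeparableSpace U]
    (J : StrongDual ℝ U →L[ℝ] E) (hJ : ∀ u, J u ∈ preadjointDomain J) :
    ∃ (N : ℕ∞) (w : Idx N → StrongDual ℝ U), Orthonormal ℝ (fun k => J (w k)) ∧
      ∀ v, J v ∈ (Submodule.span ℝ (Set.range fun k => J (w k))).topologicalClosure := by
  obtain ⟨v, hv⟩ := exists_separating_seq (U := U)
  let f : ℕ → E := fun m => J (v m)
  let g : ℕ → E := InnerProductSpace.gramSchmidtNormed ℝ f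
  have hspan : Submodule.span ℝ (Set.range g) = Submodule.span ℝ (Set.range f) := by
    rw [InnerProductSpace.span_gramSchmidtNormed_range, InnerProductSpace.span_gramSchmidt]
  have hrange : ∀ k, ∃ w, J w = g k := by
    intro k
    have h1 : g k ∈ Submodule.span ℝ (Set.range f) :=
      hspan ▸ Submodule.subset_span (Set.mem_range_self k)
    have h2 : Submodule.span ℝ (Set.range f) ≤ LinearMap.range J.toLinearMap := by
      rw [Submodule.span_le]
      rintro _ ⟨m, rfl⟩
      exact ⟨v m, rfl⟩
    exact h2 h1
  choose w hw using hrange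
  -- Normalized Gram–Schmidt returns 0 at linearly dependent steps; these indices are discarded and
  -- the rest renumbered, which leaves the span unchanged.
  obtain ⟨N, ⟨φ⟩⟩ := exists_equiv_idx {k | g k ≠ 0}
  have hJw : (fun k => J (w (φ k))) = (fun k : {k | g k ≠ 0} => g k) ∘ φ := by
    ext k
    exact hw _
  refine ⟨N, fun k => w (φ k), ?_, fun u => ?_⟩
  · rw [hJw]
    exact (InnerProductSpace.gramSchmidtNormed_orthonormal' f).comp φ φ.injective
  · have hspan' : Submodule.span ℝ (Set.range fun k => J (w (φ k)))
        = Submodule.span ℝ (Set.range f) := by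
      rw [hJw, φ.surjective.range_comp, ← hspan]
      have : Set.range (fun k : {k | g k ≠ 0} => g k) = Set.range g \ {0} := by
        ext x
        constructor
        · rintro ⟨k, rfl⟩
          exact ⟨⟨_, rfl⟩, k.2⟩
        · rintro ⟨⟨k, rfl⟩, hk⟩
          exact ⟨⟨k, hk⟩, rfl⟩
      rw [this, Submodule.span_sdiff_singleton_zero]
    rw [hspan']
    set K := (Submodule.span ℝ (Set.range f)).topologicalClosure with hK
    have hKc : IsClosed (K : Set E) := Submodule.isClosed_topologicalClosure _
    have : CompleteSpace K := hKc.completeSpace_coe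
    have hKdom : K ≤ preadjointDomain J :=
      Submodule.topologicalClosure_minimal _ (Submodule.span_le.2 (by
        rintro _ ⟨m, rfl⟩
        exact hJ _)) (isClosed_preadjointDomain J)
    -- The adjoint of `J` maps `y` to some `z` in `U`. Since `y` is orthogonal to each `J (v m)`,
    -- every `v m` kills `z`, so `z = 0`. Hence `y` is orthogonal to `J u` as well, and so to
    -- itself.
    set y := J u - K.starProjection (J u) with hy
    have hyK : y ∈ Kᗮ := K.sub_starProjection_mem_orthogonal (J u)
    have hydom : y ∈ preadjointDomain J :=
      Submodule.sub_mem _ (hJ u) (hKdom (K.starProjection_apply_mem _))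
    obtain ⟨z, hz⟩ := mem_preadjointDomain.1 hydom
    have hz0 : z = 0 := hv z fun m => by
      rw [hz]
      exact Submodule.inner_left_of_mem_orthogonal
        (Submodule.le_topologicalClosure _ (Submodule.subset_span (Set.mem_range_self m))) hyK
    have hyJ : inner ℝ y (J u) = 0 := by rw [← hz, hz0, map_zero]
    have hyp : inner ℝ y (K.starProjection (J u)) = 0 :=
      Submodule.inner_left_of_mem_orthogonal (K.starProjection_apply_mem _) hyK
    have hyy : inner ℝ y y = 0 := by
      conv_lhs => rw [hy, inner_sub_right, ← hy, hyJ, hyp]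
      simp
    have hy0 : y = 0 := inner_self_eq_zero.1 hyy
    rw [sub_eq_zero.1 (hy ▸ hy0 : J u - K.starProjection (J u) = 0)]
    exact K.starProjection_apply_mem _

/-- Given a Hilbert basis `e` of `X` and an orthonormal family `J (w k)` in `E` whose span has the
range of `J` in its closure, the isometry `e k ↦ J (w k)` followed by the adjoint of `J`. -/
lemma exists_embedding (J : StrongDual ℝ U →L[ℝ] E) (hJ : ∀ u, J u ∈ preadjointDomain J)
    {ι : Type*} {w : ι → StrongDual ℝ U} (hw : Orthonormal ℝ fun k => J (w k))
    (hspan : ∀ v, J v ∈ (Submodule.span ℝ (Set.range fun k => J (w k))).topologicalClosure)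
    {X : Type*} [NormedAddCommGroup X] [InnerProductSpace ℝ X] (e : HilbertBasis ι ℝ X) :
    ∃ i : X →L[ℝ] U, ∀ v, HasSum (fun k => v (i (e k)) • J (w k)) (J v) := by
  classical
  let T : X →ₗᵢ[ℝ] E := hw.orthogonalFamily.linearIsometry.comp e.repr.toLinearIsometry
  have hTe : ∀ k, T (e k) = J (w k) := by
    intro k
    change hw.orthogonalFamily.linearIsometry (e.repr (e k)) = _
    rw [e.repr_self, OrthogonalFamily.linearIsometry_apply_single]
    simp
  have hTrange : ∀ x, HasSum (fun k => (e.repr x k) • J (w k)) (T x) := by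
    intro x
    have := (e.hasSum_repr x).mapL T.toContinuousLinearMap
    simpa [hTe] using this
  have hTdom : ∀ x, T x ∈ preadjointDomain J := fun x =>
    (isClosed_preadjointDomain J).mem_of_tendsto (hTrange x) (.of_forall fun s =>
      Submodule.sum_mem _ fun k _ => Submodule.smul_mem _ _ (hJ _))
  obtain ⟨i, hi⟩ := exists_preadjoint J T.toContinuousLinearMap hTdom
  refine ⟨i, fun v => ?_⟩
  have : CompleteSpace X := e.repr.toIsometryEquiv.completeSpace
  have hclosed : IsClosed (LinearMap.range T.toLinearMap : Set E) :=
    T.isometry.isClosedEmbedding.isClosed_range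
  have hle := Submodule.topologicalClosure_minimal
    (Submodule.span ℝ (Set.range fun k => J (w k)))
    (t := LinearMap.range T.toLinearMap)
    (Submodule.span_le.2 (by
      rintro _ ⟨k, rfl⟩
      exact ⟨e k, hTe k⟩)) hclosed
  -- The coordinates of this preimage of `J v` turn out to be `v (i (e k))`.
  obtain ⟨x, hx⟩ := hle (hspan v)
  change T x = J v at hx
  have hcoef : ∀ k, v (i (e k)) = e.repr x k := by
    intro k
    rw [hi, ← hx, e.repr_apply_apply]
    exact T.inner_map_map _ _
  simp_rw [hcoef]
  exact hx ▸ hTrange x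

end Hilbert

end CylFBM
namespace CylFBM

/-! ### Finite-dimensional projections and joint covariances -/

section Projections

variable {Ω : Type*} [MeasurableSpace Ω] {P : Measure Ω}
  {U : Type*} [NormedAddCommGroup U] [NormedSpace ℝ U] {H : ℝ}
  {B : ℝ≥0 → StrongDual ℝ U →ₗ[ℝ] (Ω →ₘ[P] ℝ)}

/-- Positivity of `H` matters: the last term is a power of 0, and `0 ^ 0 = 1`. -/
lemma R_one_one (hH : 0 < H) : R H 1 1 = 1 := by
  simp [R, Real.zero_rpow (by positivity : 2 * H ≠ 0)]

/-- A family of random variables is jointly fractional Brownian as soon as it is jointly Gaussian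
with the covariance of a fractional Brownian motion. -/
lemma isFBm_projection {C : StrongDual ℝ U → StrongDual ℝ U → ℝ}
    (hG : IsGaussianProcess (fun (p : StrongDual ℝ U × ℝ≥0) ω => B p.2 p.1 ω) P)
    (hmean : ∀ t u, ∫ ω, B t u ω ∂P = 0)
    (hcov : ∀ s t u v, ∫ ω, B s u ω * B t v ω ∂P = C u v * R H s t)
    (n : ℕ) (u : Fin n → StrongDual ℝ U) :
    IsFBm P H (fun (t : ℝ≥0) (ω : Ω) =>
      (WithLp.toLp 2 (fun j => B t (u j) ω) : EuclideanSpace ℝ (Fin n))) := by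
  classical
  have hL2 : ∀ t u, MemLp (B t u) 2 P := fun t u => (hG.hasGaussianLaw_eval (u, t)).memLp_two
  have := hG.isProbabilityMeasure
  -- The transposed index order matches `⟨M α, β⟩` without using symmetry of `C`.
  refine ⟨Matrix.toEuclideanLin (Matrix.of fun j k => C (u k) (u j)), ?_, ?_, ?_, ?_⟩
  · intro t
    exact (WithLp.measurable_toLp 2 _).comp
      (measurable_pi_lambda _ fun j => (B t (u j)).measurable)
  · refine hG.of_isGaussianProcess fun s => ⟨Finset.univ.image fun j => (u j, s), ?_⟩
    refine ⟨(PiLp.continuousLinearEquiv 2 ℝ (fun _ : Fin n => ℝ)).symm.toContinuousLinearMap.comp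
      (ContinuousLinearMap.pi fun j => ContinuousLinearMap.proj
        ⟨(u j, s), Finset.mem_image_of_mem _ (Finset.mem_univ j)⟩), fun ω => ?_⟩
    rfl
  · intro s α
    simp only [PiLp.inner_apply, RCLike.inner_apply, conj_trivial]
    rw [integral_finsetSum _ fun j _ => ((hL2 s (u j)).integrable one_le_two).mul_const _]
    refine Finset.sum_eq_zero fun j _ => ?_
    rw [integral_mul_const, hmean, zero_mul]
  · intro s t α β
    simp only [PiLp.inner_apply, RCLike.inner_apply, conj_trivial, Finset.sum_mul_sum]
    have hint : ∀ j k, Integrable (fun ω => B s (u j) ω * α j * (B t (u k) ω * β k)) P := by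
      intro j k
      have := ((hL2 s (u j)).integrable_mul (hL2 t (u k))).mul_const (α j * β k)
      refine this.congr (.of_forall fun ω => ?_)
      simp only [Pi.mul_apply]
      ring
    rw [integral_finsetSum _ fun j _ => integrable_finsetSum _ fun k _ => hint j k]
    simp_rw [integral_finsetSum _ fun k _ => hint _ k]
    have hval : ∀ j k, ∫ ω, B s (u j) ω * α j * (B t (u k) ω * β k) ∂P
        = α j * β k * C (u j) (u k) * R H s t := by
      intro j k
      rw [mul_assoc, ← hcov s t, ← integral_const_mul]
      congr 1
      ext ω
      ring
    simp_rw [hval]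
    rw [Finset.sum_comm, Finset.sum_mul]
    refine Finset.sum_congr rfl fun k _ => ?_
    simp only [Matrix.toLpLin_apply, Matrix.mulVec, dotProduct, Matrix.of_apply,
      Finset.mul_sum, Finset.sum_mul]
    exact Finset.sum_congr rfl fun j _ => by ring

/-- Finitely many pairs involve finitely many functionals and times, so one projection, restricted
to those times, contains them all. -/
lemma isGaussianProcess_of_projections
    (hB : ∀ (n : ℕ) (u : Fin n → StrongDual ℝ U), IsFBm P H (fun (t : ℝ≥0) (ω : Ω) =>
      (WithLp.toLp 2 (fun j => B t (u j) ω) : EuclideanSpace ℝ (Fin n)))) :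
    IsGaussianProcess (fun (p : StrongDual ℝ U × ℝ≥0) ω => B p.2 p.1 ω) P where
  hasGaussianLaw I := by
    classical
    let A := I.image Prod.fst
    let D := I.image Prod.snd
    obtain ⟨M, hM⟩ := hB A.card fun j => (A.equivFin.symm j : StrongDual ℝ U)
    let L : (D → EuclideanSpace ℝ (Fin A.card)) →L[ℝ] (I → ℝ) :=
      ContinuousLinearMap.pi fun p =>
        (EuclideanSpace.proj (𝕜 := ℝ) (A.equivFin ⟨p.1.1, Finset.mem_image_of_mem _ p.2⟩)).comp
        (ContinuousLinearMap.proj (R := ℝ) (φ := fun _ : D => EuclideanSpace ℝ (Fin A.card))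
          ⟨p.1.2, Finset.mem_image_of_mem _ p.2⟩)
    refine ((hM.gaussian.hasGaussianLaw D).map L).congr (.of_forall fun ω => ?_)
    ext p
    simp [L]

lemma integral_eq_zero_of_projections
    (hB : ∀ (n : ℕ) (u : Fin n → StrongDual ℝ U), IsFBm P H (fun (t : ℝ≥0) (ω : Ω) =>
      (WithLp.toLp 2 (fun j => B t (u j) ω) : EuclideanSpace ℝ (Fin n))))
    (t : ℝ≥0) (u : StrongDual ℝ U) : ∫ ω, B t u ω ∂P = 0 := by
  obtain ⟨M, hM⟩ := hB 1 ![u]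
  simpa [EuclideanSpace.inner_single_left] using hM.mean t (EuclideanSpace.single 0 1)

/-- The two-dimensional projection supplies a single matrix for all times; its entry is read off at
`s = t = 1`. -/
lemma integral_mul_of_projections (hH : 0 < H)
    (hB : ∀ (n : ℕ) (u : Fin n → StrongDual ℝ U), IsFBm P H (fun (t : ℝ≥0) (ω : Ω) =>
      (WithLp.toLp 2 (fun j => B t (u j) ω) : EuclideanSpace ℝ (Fin n))))
    (s t : ℝ≥0) (u v : StrongDual ℝ U) :
    ∫ ω, B s u ω * B t v ω ∂P = (∫ ω, B 1 u ω * B 1 v ω ∂P) * R H s t := by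
  obtain ⟨M, hM⟩ := hB 2 ![u, v]
  have h := fun s t => hM.cov s t (EuclideanSpace.single 0 1) (EuclideanSpace.single 1 1)
  have h1 := h 1 1
  rw [R_one_one hH, mul_one] at h1
  have h2 := h s t
  rw [← h1] at h2
  simpa [EuclideanSpace.inner_single_left] using h2

end Projections

/-! ### Law and covariance of a series representation -/

section Series

variable {Ω : Type*} [MeasurableSpace Ω] {P : Measure Ω}
  {U : Type*} [NormedAddCommGroup U] [NormedSpace ℝ U] {H : ℝ}
  {B : ℝ≥0 → StrongDual ℝ U →ₗ[ℝ] (Ω →ₘ[P] ℝ)}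
  {X : Type*} [NormedAddCommGroup X] [InnerProductSpace ℝ X]
  {N : ℕ∞} {e : HilbertBasis (Idx N) ℝ X} {i : X →L[ℝ] U} {b : Idx N → ℝ≥0 → Ω → ℝ}

namespace IsStandardRealFBm

lemma memLp {c : ℝ≥0 → Ω → ℝ} (hc : IsStandardRealFBm P H c) (t : ℝ≥0) : MemLp (c t) 2 P :=
  (hc.gaussian.hasGaussianLaw_eval t).memLp_two

lemma integral_eq_zero {c : ℝ≥0 → Ω → ℝ} (hc : IsStandardRealFBm P H c) (t : ℝ≥0) :
    ∫ ω, c t ω ∂P = 0 := by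
  simpa using hc.mean t 1

lemma integral_mul {c : ℝ≥0 → Ω → ℝ} (hc : IsStandardRealFBm P H c) (s t : ℝ≥0) :
    ∫ ω, c s ω * c t ω ∂P = R H s t := by
  simpa using hc.cov s t 1 1

end IsStandardRealFBm

namespace IsSeriesRepresentation

lemma integral_mul_eq (h : IsSeriesRepresentation P H B e i b) (s t : ℝ≥0) (k l : Idx N) :
    ∫ ω, b k s ω * b l t ω ∂P = if k = l then R H s t else 0 := by
  split_ifs with hkl
  · rw [hkl, (h.standard l).integral_mul]
  · have hind : IndepFun (b k s) (b l t) P :=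
      (h.indep.indepFun hkl).comp (measurable_pi_apply s) (measurable_pi_apply t)
    rw [hind.integral_fun_mul_eq_mul_integral ((h.standard k).memLp s).1
      ((h.standard l).memLp t).1, (h.standard k).integral_eq_zero, zero_mul]

lemma memLp_sum (h : IsSeriesRepresentation P H B e i b) (t : ℝ≥0) (u : StrongDual ℝ U) (n : ℕ) :
    MemLp (fun ω => ∑ k ∈ firstIdx N n, u (i (e k)) * b k t ω) 2 P :=
  memLp_finsetSum _ fun k _ => ((h.standard k).memLp t).const_mul _

lemma memLp (h : IsSeriesRepresentation P H B e i b) (t : ℝ≥0) (u : StrongDual ℝ U) :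
    MemLp (B t u) 2 P :=
  memLp_of_tendsto_eLpNorm (B t u).aestronglyMeasurable (h.memLp_sum t u) (h.series t u)

lemma isGaussianProcess_eval [IsProbabilityMeasure P] (h : IsSeriesRepresentation P H B e i b) :
    IsGaussianProcess (fun (p : StrongDual ℝ U × ℝ≥0) ω => B p.2 p.1 ω) P := by
  classical
  have hb := isGaussianProcess_of_iIndepFun (fun k => (h.standard k).gaussian) h.indep
  refine isGaussianProcess_of_tendsto_eLpNorm
    (S := fun n p ω => ∑ k ∈ firstIdx N n, p.1 (i (e k)) * b k p.2 ω)
    (fun p => (B p.2 p.1).aestronglyMeasurable) (fun n => ?_) fun p => h.series p.2 p.1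
  refine hb.of_isGaussianProcess fun p => ⟨(firstIdx N n).image fun k => (k, p.2), ?_⟩
  refine ⟨∑ k : firstIdx N n, (p.1 (i (e k))) • ContinuousLinearMap.proj
    ⟨((k : Idx N), p.2), Finset.mem_image_of_mem _ k.2⟩, fun ω => ?_⟩
  rw [← Finset.sum_coe_sort]
  simp [Finset.restrict]

lemma integral_eq_zero [IsProbabilityMeasure P] (h : IsSeriesRepresentation P H B e i b)
    (t : ℝ≥0) (u : StrongDual ℝ U) : ∫ ω, B t u ω ∂P = 0 := by
  have hlim := tendsto_integral_mul (h.memLp t u) (memLp_const (1 : ℝ)) (h.memLp_sum t u)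
    (fun _ => memLp_const 1) (h.series t u) (by simp)
  simp only [mul_one] at hlim
  refine tendsto_nhds_unique hlim (tendsto_const_nhds.congr fun n => ?_)
  rw [integral_finsetSum _ fun k _ =>
    (((h.standard k).memLp t).integrable one_le_two).const_mul _]
  refine (Finset.sum_eq_zero fun k _ => ?_).symm
  rw [integral_const_mul, (h.standard k).integral_eq_zero, mul_zero]

lemma inner_adjointOp [CompleteSpace X] (i : X →L[ℝ] U) (u : StrongDual ℝ U) (x : X) :
    inner ℝ (adjointOp i u) x = u (i x) := by
  simp [adjointOp]

/-- The covariances of the partial sums are truncated Parseval sums for the inner product of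
`adjointOp i u` and `adjointOp i v`, times `R H s t`. -/
lemma integral_mul [CompleteSpace X] (h : IsSeriesRepresentation P H B e i b)
    (s t : ℝ≥0) (u v : StrongDual ℝ U) :
    ∫ ω, B s u ω * B t v ω ∂P = v (i (adjointOp i u)) * R H s t := by
  have hlim := tendsto_integral_mul (h.memLp s u) (h.memLp t v) (h.memLp_sum s u)
    (h.memLp_sum t v) (h.series s u) (h.series t v)
  have hval : ∀ n, ∫ ω, (∑ k ∈ firstIdx N n, u (i (e k)) * b k s ω) *
      (∑ l ∈ firstIdx N n, v (i (e l)) * b l t ω) ∂P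
      = (∑ k ∈ firstIdx N n, u (i (e k)) * v (i (e k))) * R H s t := by
    intro n
    simp only [Finset.sum_mul_sum]
    have hint : ∀ k l, Integrable (fun ω => u (i (e k)) * b k s ω * (v (i (e l)) * b l t ω)) P :=
      fun k l => (((h.standard k).memLp s).const_mul _).integrable_mul
        (((h.standard l).memLp t).const_mul _)
    rw [integral_finsetSum _ fun k _ => integrable_finsetSum _ fun l _ => hint k l, Finset.sum_mul]
    refine Finset.sum_congr rfl fun k hk => ?_
    rw [integral_finsetSum _ fun l _ => hint k l, Finset.sum_eq_single_of_mem k hk]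
    -- `R H s t` is put back in conditional form so that `integral_mul_eq` can be used from right to
    -- left.
    · rw [← if_pos (rfl : k = k) (t := R H s t) (e := 0), ← h.integral_mul_eq,
        ← integral_const_mul]
      congr 1
      ext ω
      ring
    · intro l _ hl
      have : ∀ ω, u (i (e k)) * b k s ω * (v (i (e l)) * b l t ω)
          = u (i (e k)) * v (i (e l)) * (b k s ω * b l t ω) := fun ω => by ring
      simp_rw [this]
      rw [integral_const_mul, h.integral_mul_eq, if_neg hl.symm, mul_zero]
  refine tendsto_nhds_unique hlim (Tendsto.congr (fun n => (hval n).symm) (Tendsto.mul_const _ ?_))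
  have hsum := e.hasSum_inner_mul_inner (adjointOp i u) (adjointOp i v)
  have hT := hsum.comp (tendsto_firstIdx N)
  rw [← inner_adjointOp i v, real_inner_comm]
  refine hT.congr fun n => Finset.sum_congr rfl fun k _ => ?_
  beta_reduce
  rw [inner_adjointOp, real_inner_comm, inner_adjointOp]

lemma hasCovarianceOperator [CompleteSpace X] (hH : 0 < H)
    (h : IsSeriesRepresentation P H B e i b) :
    HasCovarianceOperator P (B 1) (fun u => i (adjointOp i u)) :=
  ⟨h.memLp 1, fun u v => by rw [h.integral_mul, R_one_one hH, mul_one]⟩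

lemma isCylindricalFBm [IsProbabilityMeasure P] [CompleteSpace X] (hH : 0 < H)
    (hB : IsCylindricalProcess P B) (h : IsSeriesRepresentation P H B e i b) :
    IsCylindricalFBm P H B where
  isCylindricalProcess := hB
  projections := isFBm_projection h.isGaussianProcess_eval h.integral_eq_zero h.integral_mul
  covariance := ⟨_, h.hasCovarianceOperator hH⟩

end IsSeriesRepresentation

end Series

end CylFBM
namespace CylFBM

/-! ### Construction of the series from the fBm -/

section Construction

variable {Ω : Type*} [MeasurableSpace Ω] {P : Measure Ω}
  {U : Type*} [NormedAddCommGroup U] [NormedSpace ℝ U] {H : ℝ}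
  {B : ℝ≥0 → StrongDual ℝ U →ₗ[ℝ] (Ω →ₘ[P] ℝ)}

/-- A square integrable linear map into `L⁰`, regarded as a map into `L²`. -/
noncomputable def toL2 (Z : StrongDual ℝ U →ₗ[ℝ] (Ω →ₘ[P] ℝ)) (hZ : ∀ u, MemLp (Z u) 2 P) :
    StrongDual ℝ U →ₗ[ℝ] Lp ℝ 2 P where
  toFun u := ⟨Z u, Lp.mem_Lp_iff_memLp.2 (hZ u)⟩
  map_add' u v := Subtype.ext (map_add Z u v)
  map_smul' c u := Subtype.ext (map_smul Z c u)

lemma coe_toL2 {Z : StrongDual ℝ U →ₗ[ℝ] (Ω →ₘ[P] ℝ)} {hZ : ∀ u, MemLp (Z u) 2 P}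
    (u : StrongDual ℝ U) : (toL2 Z hZ u : Ω →ₘ[P] ℝ) = Z u := rfl

lemma inner_toL2 {Z W : StrongDual ℝ U →ₗ[ℝ] (Ω →ₘ[P] ℝ)} {hZ : ∀ u, MemLp (Z u) 2 P}
    {hW : ∀ u, MemLp (W u) 2 P} (u v : StrongDual ℝ U) :
    inner ℝ (toL2 Z hZ u) (toL2 W hW v) = ∫ ω, Z u ω * W v ω ∂P := by
  rw [L2.inner_def]
  refine integral_congr_ae (.of_forall fun ω => ?_)
  simp [coe_toL2, mul_comm]

/-- A square integrable cylindrical random variable is continuous into `L²`, by the closed graph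
theorem. -/
lemma continuous_toL2 {Z : StrongDual ℝ U →ₗ[ℝ] (Ω →ₘ[P] ℝ)} (hZ : ∀ u, MemLp (Z u) 2 P)
    (hc : IsCylindricalRandomVariable P Z) : Continuous (toL2 Z hZ) := by
  -- L² convergence implies convergence in probability, whose limits are a.e. unique; this closes
  -- the graph.
  refine LinearMap.continuous_of_seq_closed_graph _ fun u x y hu hy => ?_
  have h1 : TendstoInMeasure P (fun n => (toL2 Z hZ (u n) : Ω → ℝ)) atTop y :=
    tendstoInMeasure_of_tendsto_Lp (f := fun n => toL2 Z hZ (u n)) hy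
  simp_rw [coe_toL2] at h1
  have h2 : TendstoInMeasure P (fun n => (Z (u n) : Ω → ℝ)) atTop (Z x) := fun ε hε =>
    (hc x ε hε).comp hu
  have h3 : (y : Ω → ℝ) =ᵐ[P] Z x := tendstoInMeasure_ae_unique h1 h2
  refine Lp.ext ?_
  rw [coe_toL2]
  exact h3

/-- The projections `B(t) w_k` of a cylindrical fractional Brownian motion on functionals `w_k`
that are orthonormal for its covariance are independent standard fractional Brownian motions. -/
lemma IsCylindricalFBm.standard_indep_projections (hH : 0 < H) (h : IsCylindricalFBm P H B)
    {ι : Type*} [DecidableEq ι] {w : ι → StrongDual ℝ U}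
    (hw : ∀ k l, ∫ ω, B 1 (w k) ω * B 1 (w l) ω ∂P = if k = l then 1 else 0) :
    (∀ k, IsStandardRealFBm P H fun t ω => B t (w k) ω) ∧
      iIndepFun (fun k ω t => B t (w k) ω) P := by
  have hG := isGaussianProcess_of_projections h.projections
  have hP := hG.isProbabilityMeasure
  have hmean := integral_eq_zero_of_projections h.projections
  have hcov := integral_mul_of_projections hH h.projections
  have hL2 : ∀ t u, MemLp (B t u) 2 P := fun t u => (hG.hasGaussianLaw_eval (u, t)).memLp_two
  refine ⟨fun k => ⟨fun t => (B t (w k)).measurable, hG.comp_right fun t => (w k, t), ?_, ?_⟩, ?_⟩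
  · intro s α
    simp only [RCLike.inner_apply, conj_trivial]
    rw [integral_mul_const, hmean, zero_mul]
  · intro s t α β
    have : ∀ ω, (inner ℝ α (B s (w k) ω) * inner ℝ β (B t (w k) ω) : ℝ)
        = α * β * (B s (w k) ω * B t (w k) ω) := fun ω => by
      simp only [RCLike.inner_apply, conj_trivial]
      ring
    simp_rw [this]
    rw [integral_const_mul, hcov, hw, if_pos rfl, one_mul]
    simp [mul_comm]
  -- Joint Gaussianity over all pairs `(k, t)` upgrades vanishing cross-covariances to independence
  -- of whole processes.
  · refine IsGaussianProcess.iIndepFun_of_covariance_eq_zero (S := fun _ => ℝ≥0)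
      (hG.comp_right fun p : (_ : ι) × ℝ≥0 => (w p.1, p.2))
      (fun k t => (B t (w k)).measurable.aemeasurable) fun k l hkl s t => ?_
    rw [covariance_eq_sub (hL2 s _) (hL2 t _), hmean, zero_mul, sub_zero]
    change ∫ ω, B s (w k) ω * B t (w l) ω ∂P = 0
    rw [hcov, hw, if_neg hkl, zero_mul]

/-- A Hilbert space with a Hilbert basis indexed by `ι`, in an arbitrary universe. -/
lemma nonempty_hilbertBasis_lp.{v, w} (ι : Type w) :
    Nonempty (HilbertBasis ι ℝ (lp (fun _ : ULift.{v} ι => ℝ) 2)) := by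
  classical
  let e : HilbertBasis (ULift.{v} ι) ℝ (lp (fun _ : ULift.{v} ι => ℝ) 2) :=
    HilbertBasis.ofRepr (LinearIsometryEquiv.refl ℝ _)
  refine ⟨HilbertBasis.mk (v := fun k => e (ULift.up k))
    (e.orthonormal.comp _ ULift.up_injective) ?_⟩
  have : Set.range (fun k : ι => e (ULift.up k)) = Set.range e :=
    ULift.up_surjective.range_comp e
  rw [this, e.dense_span]

/-- A cylindrical fractional Brownian motion has a series representation over some Hilbert space
with countable orthonormal basis. -/
lemma IsCylindricalFBm.exists_isSeriesRepresentation [CompleteSpace U]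
    [TopologicalSpace.SeparableSpace U] (hH : 0 < H) (h : IsCylindricalFBm P H B) :
    ∃ (X : Type*) (_ : NormedAddCommGroup X) (_ : InnerProductSpace ℝ X) (_ : CompleteSpace X)
      (N : ℕ∞) (e : HilbertBasis (Idx N) ℝ X) (i : X →L[ℝ] U) (b : Idx N → ℝ≥0 → Ω → ℝ),
      IsSeriesRepresentation P H B e i b := by
  have hG := isGaussianProcess_of_projections h.projections
  have hL2 : ∀ t u, MemLp (B t u) 2 P := fun t u => (hG.hasGaussianLaw_eval (u, t)).memLp_two
  have hcov := integral_mul_of_projections hH h.projections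
  let J : StrongDual ℝ U →L[ℝ] Lp ℝ 2 P :=
    ⟨toL2 (B 1) (hL2 1), continuous_toL2 _ (h.1 1)⟩
  have hJ : ∀ u v, inner ℝ (J u) (J v) = ∫ ω, B 1 u ω * B 1 v ω ∂P := fun u v => inner_toL2 (hZ := hL2 1) (hW := hL2 1) u v
  obtain ⟨Q, -, hQ⟩ := h.covariance
  have hdom : ∀ u, J u ∈ preadjointDomain J := fun u =>
    mem_preadjointDomain.2 ⟨Q u, fun v => by rw [hQ, hJ]⟩
  obtain ⟨N, w, hw, hspan⟩ := exists_orthonormal_range J hdom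
  obtain ⟨e⟩ := nonempty_hilbertBasis_lp (Idx N)
  obtain ⟨i, hi⟩ := exists_embedding J hdom hw hspan e
  classical
  obtain ⟨hstd, hind⟩ := h.standard_indep_projections hH (w := w) fun k l => by
    rw [← hJ, orthonormal_iff_ite.1 hw]
  refine ⟨_, inferInstance, inferInstance, inferInstance, N, e, i, fun k t ω => B t (w k) ω,
    hstd, hind, fun t u => ?_⟩
  -- By linearity the error of the partial sum at time `t` is `B t (r n)`, with `r n` independent of
  -- `t`; its L² norm is thus controlled by `‖J (r n)‖`.
  let r : ℕ → StrongDual ℝ U := fun n => u - ∑ k ∈ firstIdx N n, u (i (e k)) • w k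
  have hnorm : ∀ v, ‖toL2 (B t) (hL2 t) v‖ = √(R H t t) * ‖J v‖ := by
    intro v
    rw [norm_eq_sqrt_real_inner, inner_toL2, hcov, ← hJ, mul_comm, real_inner_self_eq_norm_sq,
      Real.sqrt_mul' _ (sq_nonneg _), Real.sqrt_sq (norm_nonneg _)]
  have hJr : Tendsto (fun n => ‖J (r n)‖) atTop (𝓝 0) := by
    have h1 := ((hi u).comp (tendsto_firstIdx N)).const_sub (J u)
    rw [sub_self] at h1
    refine h1.norm.congr' (.of_forall fun n => ?_) |>.trans (by rw [norm_zero])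
    simp [r]
  have hBr : Tendsto (fun n => toL2 (B t) (hL2 t) (r n)) atTop (𝓝 0) := by
    rw [tendsto_zero_iff_norm_tendsto_zero]
    simp_rw [hnorm]
    simpa using hJr.const_mul (√(R H t t))
  rw [Lp.tendsto_Lp_iff_tendsto_eLpNorm'] at hBr
  refine hBr.congr fun n => eLpNorm_congr_ae ?_
  -- Linearity of `B t` holds between classes, hence only almost everywhere for representatives.
  have hsum : ∀ s : Finset (Idx N), (B t (∑ k ∈ s, u (i (e k)) • w k) : Ω → ℝ) =ᵐ[P]
      fun ω => ∑ k ∈ s, u (i (e k)) * B t (w k) ω := by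
    intro s
    induction s using Finset.induction_on with
    | empty => simpa using! AEEqFun.coeFn_zero
    | insert k s hk ih =>
      simp_rw [Finset.sum_insert hk, map_add, map_smul]
      filter_upwards [ih, AEEqFun.coeFn_add (u (i (e k)) • B t (w k))
        (B t (∑ k ∈ s, u (i (e k)) • w k)), AEEqFun.coeFn_smul (u (i (e k))) (B t (w k))]
        with ω h1 h2 h3
      rw [h2, Pi.add_apply, h1, h3, Pi.smul_apply, smul_eq_mul]
  have hsub : (B t (r n) : Ω → ℝ) =ᵐ[P] B t u - B t (∑ k ∈ firstIdx N n, u (i (e k)) • w k) := by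
    rw [map_sub]
    exact AEEqFun.coeFn_sub _ _
  filter_upwards [hsum (firstIdx N n), hsub, Lp.coeFn_zero ℝ 2 P] with ω h1 h2 h3
  rw [Pi.sub_apply, h3, coe_toL2, h2, Pi.sub_apply, h1]
  simp

end Construction

end CylFBM
theorem theorem4p3
    {Ω : Type*} [MeasurableSpace Ω] (P : Measure Ω) [IsProbabilityMeasure P]
    {U : Type*} [NormedAddCommGroup U] [NormedSpace ℝ U] [CompleteSpace U]
    [TopologicalSpace.SeparableSpace U]
    (H : ℝ) (hH : 0 < H ∧ H < 1)
    (B : ℝ≥0 → StrongDual ℝ U →ₗ[ℝ] (Ω →ₘ[P] ℝ))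
    (hB : CylFBM.IsCylindricalProcess P B) :
    (CylFBM.IsCylindricalFBm P H B ↔
      ∃ (X : Type*) (_ : NormedAddCommGroup X) (_ : InnerProductSpace ℝ X) (_ : CompleteSpace X)
        (N : ℕ∞) (e : HilbertBasis (CylFBM.Idx N) ℝ X) (i : X →L[ℝ] U)
        (b : CylFBM.Idx N → ℝ≥0 → Ω → ℝ),
        CylFBM.IsSeriesRepresentation P H B e i b) ∧
    (∀ (X : Type*) [NormedAddCommGroup X] [InnerProductSpace ℝ X] [CompleteSpace X]
        (N : ℕ∞) (e : HilbertBasis (CylFBM.Idx N) ℝ X) (i : X →L[ℝ] U)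
        (b : CylFBM.Idx N → ℝ≥0 → Ω → ℝ),
        CylFBM.IsSeriesRepresentation P H B e i b →
          CylFBM.HasCovarianceOperator P (B 1) (fun u => i (CylFBM.adjointOp i u))) := by
  refine ⟨⟨fun h => h.exists_isSeriesRepresentation hH.1, ?_⟩, ?_⟩
  · rintro ⟨X, _, _, _, N, e, i, b, h⟩
    exact h.isCylindricalFBm hH.1 hB
  · intro X _ _ _ N e i b h
    exact h.hasCovarianceOperator hH.1
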